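/- Fix an integer $d\ge 2$. For every integer $p$ let $k=k_p$ be an integer with $1\le k\le p$ for all large $p$, and put $n=p^d$ and $s=k^d$. Let $\mathcal C_{p,k}=\{0,k^{-1/2}\}^p\cap\mathcal S_{p-1}$, where $\mathcal S_{p-1}$ is the unit sphere of $\mathbb R^p$; this set has $M=\binom{p}{k}$ elements. Let $x$ be uniform on $\mathcal C_{p,k}$, let $X=x^{\otimes d}\in\mathbb R^{n}$, and for $\lambda\ge 0$ observe $Y=\sqrt{\lambda}\,X+Z$, where $Z\in\mathbb R^n$ is independent of $X$ and has independent standard Gaussian entries. Let $$\mathrm{MEP}_n(\lambda)=\min_{\hat X}\ \mathbb P[\hat X(Y)\ne X],$$ where $\hat X$ ranges over the measurable estimators with values in the closed unit ball of $\mathbb R^n$, and let $\mathrm{CMEP}_n(\lambda)$ be the same minimum over the measurable estimators with values in $\mathcal C_{n,s}=\{0,s^{-1/2}\}^n\cap\mathcal S_{n-1}$. For $1\le k\le p$ and $\lambda\ge 0$ both minima are attained by every measurable maximum-likelihood estimator, i.e. every measurable $\hat X$ for which $\hat X(Y)$ maximizes the likelihood (the density of $Y$ given $X=v$) over the signals $v\in\{x^{\otimes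 d}:x\in\mathcal C_{p,k}\}$, and such an estimator exists. Put $\lambda_n=2\log M=2\log\binom{p}{k}$. If $k=o\big((\log p)^{1/(4d-1)}\big)$ as $p\to\infty$, then $$\liminf_{n\to\infty}\mathrm{MEP}_n(\beta\lambda_n)\ge\tfrac14\quad\text{for every constant } 0\le\beta<1,\qquad \lim_{n\to\infty}\mathrm{MEP}_n(\beta\lambda_n)=0\quad\text{for every constant }\beta>1,$$ and the same two statements hold for $\mathrm{CMEP}_n(\beta\lambda_n)$. -/

import Mathlib

open MeasureTheory ProbabilityTheory Filter Topology Asymptotics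

namespace SparsePCA

noncomputable section

/-- The set `{0, m^{-1/2}}^ι ∩ S`, where `S` is the Euclidean unit sphere of `ℝ^ι`: the vectors with
exactly `m` nonzero entries, all of them equal to `m^{-1/2}`. -/
def binarySphere (ι : Type) [Fintype ι] (m : ℕ) : Set (EuclideanSpace ℝ ι) :=
  {v | (∀ i, v i = 0 ∨ v i = (√(m : ℝ))⁻¹) ∧ ‖v‖ = 1}

/-- Real tensors of order `d` on `ℝ^p`, with the Frobenius norm; this is `ℝ^n` with `n = p ^ d`. -/
abbrev Tensor (d p : ℕ) : Type := EuclideanSpace ℝ (Fin d → Fin p)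

/-- The rank-one tensor `x^{⊗ d}`, with entries `x_{i_1} ⋯ x_{i_d}`. -/
def tensorPow (d : ℕ) {p : ℕ} (x : EuclideanSpace ℝ (Fin p)) : Tensor d p :=
  WithLp.toLp 2 fun i => ∏ j, x (i j)

/-- The signal space: all `x^{⊗ d}` with `x ∈ {0, k^{-1/2}}^p` of norm one. -/
def signalSet (d p k : ℕ) : Set (Tensor d p) :=
  tensorPow d '' binarySphere (Fin p) k

/-- The law of the signal `X = x^{⊗ d}`, with `x` uniform on `{0, k^{-1/2}}^p ∩ S_{p-1}`. -/
def prior (d p k : ℕ) : Measure (Tensor d p) :=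
  (uniformOn (binarySphere (Fin p) k)).map (tensorPow d)

/-- The law of the noise tensor `Z`: independent standard Gaussian entries. -/
def noise (d p : ℕ) : Measure (Tensor d p) :=
  (Measure.pi fun _ : Fin d → Fin p => gaussianReal 0 1).map (WithLp.toLp 2)

/-- The observation `Y = √lam X + Z`. -/
def observation {d p : ℕ} (lam : ℝ) (X Z : Tensor d p) : Tensor d p := √lam • X + Z

/-- The probability that the estimator `Xhat` misses the signal, `P[Xhat(Y) ≠ X]`,
where `Y = √lam X + Z`, and `X`, `Z` are independent. -/
def errorProb (d p k : ℕ) (lam : ℝ) (Xhat : Tensor d p → Tensor d p) : ℝ :=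
  ((prior d p k).prod (noise d p)).real {ω | Xhat (observation lam ω.1 ω.2) ≠ ω.1}

/-- The least error probability over the (measurable) estimators with values in `A`. -/
def minErrorProb (d p k : ℕ) (A : Set (Tensor d p)) (lam : ℝ) : ℝ :=
  sInf (errorProb d p k lam '' {Xhat | Measurable Xhat ∧ ∀ y, Xhat y ∈ A})

/-- The minimum error probability: estimators with values in the closed unit ball of `ℝ^n`. -/
def MEP (d p k : ℕ) (lam : ℝ) : ℝ :=
  minErrorProb d p k (Metric.closedBall 0 1) lam

/-- The constrained minimum error probability: estimators with values in
`C_{n,s} = {0, s^{-1/2}}^n ∩ S_{n-1}`, with `n = p ^ d` and `s = k ^ d`. -/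
def CMEP (d p k : ℕ) (lam : ℝ) : ℝ :=
  minErrorProb d p k (binarySphere (Fin d → Fin p) (k ^ d)) lam

/-- The density at `y` of `Y` given `X = v`, that is, of the law `N(√lam v, 1)`. -/
def likelihood {d p : ℕ} (lam : ℝ) (v y : Tensor d p) : ℝ :=
  ∏ i, gaussianPDFReal (√lam * v i) 1 (y i)

/-- `Xhat` is a (measurable) maximum-likelihood estimator of the signal. -/
def IsMLE (d p k : ℕ) (lam : ℝ) (Xhat : Tensor d p → Tensor d p) : Prop :=
  Measurable Xhat ∧
    ∀ y, Xhat y ∈ signalSet d p k ∧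
      ∀ v ∈ signalSet d p k, likelihood lam v y ≤ likelihood lam (Xhat y) y

/-- The critical signal-to-noise ratio `2 log M`, with `M = binom(p, k)` the number of signals. -/
def critSNR (p k : ℕ) : ℝ := 2 * Real.log (p.choose k : ℝ)

end

end SparsePCA

namespace SparsePCA

/-! Write `L = log M` and `λ = 2βL`. Given `X = v`, the log-likelihood ratio against pure noise
concentrates at `λ/2 = βL`. If `β < 1`, fix `γ` strictly between `βL` and `L`. Off a rare event,
each decoding region gains at most a factor `exp γ` from its signal. The regions are disjoint, so
the average success probability is at most `exp γ / M` plus a small tail (`one_sub_le_errorProb`).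
If `β > 1`, bound the error of maximum likelihood. A plain union bound loses a factor two in `λ`,
because all competitors share the noise along `v`. Requiring `⟨v, Z⟩ ≥ -t` first and using only the
noise orthogonal to `v` recovers it (`noise_pairwise_le`). For supports with overlap fraction `u`,
tensor signals have inner product `u ^ d`, and `d ≥ 2` makes the exponent at least linear in `1 - u`
(`one_sub_le_div`). Grouping competitors by intersection then leaves `2 ^ k * p * q`, which vanishes
when `k = o(log p)` (`IsMLE.errorProb_le_of_gap`); the assumed growth rate implies this. Both minima
equal the maximum-likelihood error, since optimality is proved against all measurable estimators. -/

/-! ### Densities of translated Gaussian measures -/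

theorem gaussianReal_eq_withDensity (a : ℝ) :
    gaussianReal a 1 =
      (gaussianReal 0 1).withDensity fun y => ENNReal.ofReal (Real.exp (a * y - a ^ 2 / 2)) := by
  rw [gaussianReal_of_var_ne_zero a one_ne_zero, gaussianReal_of_var_ne_zero 0 one_ne_zero,
    ← withDensity_mul _ (measurable_gaussianPDF 0 1) (by fun_prop)]
  congr 1
  ext y
  simp only [Pi.mul_apply, gaussianPDF, gaussianPDFReal]
  rw [← ENNReal.ofReal_mul (by positivity), mul_assoc _ (Real.exp _), ← Real.exp_add]
  congr 3
  push_cast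
  ring

/-- A product measure is determined by its values on boxes, where independence of the coordinates
factors the integral of the density. -/
theorem pi_gaussianReal_eq_withDensity {ι : Type*} [Fintype ι] (u : ι → ℝ) :
    (Measure.pi fun i => gaussianReal (u i) 1) =
      (Measure.pi fun _ : ι => gaussianReal 0 1).withDensity fun y =>
        ∏ i, ENNReal.ofReal (Real.exp (u i * y i - u i ^ 2 / 2)) := by
  refine Measure.pi_eq fun s hs => ?_
  have hmeas : ∀ i, Measurable ((s i).indicator fun t : ℝ =>
      ENNReal.ofReal (Real.exp (u i * t - u i ^ 2 / 2))) :=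
    fun i => Measurable.indicator (by fun_prop) (hs i)
  have key := lintegral_prod_eq_prod_lintegral_of_indepFun
    (μ := Measure.pi fun _ : ι => gaussianReal 0 1) Finset.univ
    (fun i y => (s i).indicator (fun t : ℝ =>
      ENNReal.ofReal (Real.exp (u i * t - u i ^ 2 / 2))) (y i))
    (iIndepFun_pi fun i => (hmeas i).aemeasurable)
    fun i => (hmeas i).comp (measurable_pi_apply i)
  rw [withDensity_apply _ (MeasurableSet.univ_pi hs),
    ← lintegral_indicator (MeasurableSet.univ_pi hs)]
  trans ∏ i, ∫⁻ y, (s i).indicator (fun t : ℝ =>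
      ENNReal.ofReal (Real.exp (u i * t - u i ^ 2 / 2))) (y i)
        ∂(Measure.pi fun _ : ι => gaussianReal 0 1)
  · rw [← key]
    refine lintegral_congr fun y => ?_
    by_cases hy : y ∈ Set.univ.pi s
    · rw [Set.indicator_of_mem hy]
      exact Finset.prod_congr rfl fun i _ => (Set.indicator_of_mem (hy i trivial) fun t : ℝ =>
        ENNReal.ofReal (Real.exp (u i * t - u i ^ 2 / 2))).symm
    · rw [Set.indicator_of_notMem hy]
      obtain ⟨i, hi⟩ : ∃ i, y i ∉ s i := by simpa using hy
      exact (Finset.prod_eq_zero (Finset.mem_univ i) (Set.indicator_of_notMem hi _)).symm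
  · refine Finset.prod_congr rfl fun i _ => ?_
    rw [gaussianReal_eq_withDensity (u i), withDensity_apply _ (hs i),
      ← lintegral_indicator (hs i),
      ← (measurePreserving_eval (fun _ : ι => gaussianReal 0 1) i).lintegral_comp (hmeas i)]

/-! ### Likelihood ratios and exponential moments of the noise -/

section Estimation

variable {d p : ℕ}

/-- The likelihood ratio of `N(u, 1)` to `N(0, 1)`. -/
noncomputable def likelihoodRatio (u y : Tensor d p) : ℝ := Real.exp (inner ℝ u y - ‖u‖ ^ 2 / 2)

theorem likelihoodRatio_pos (u y : Tensor d p) : 0 < likelihoodRatio u y := Real.exp_pos _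

theorem continuous_likelihoodRatio (u : Tensor d p) : Continuous (likelihoodRatio u) := by
  unfold likelihoodRatio
  fun_prop

theorem likelihoodRatio_eq_prod (u y : Tensor d p) :
    likelihoodRatio u y = ∏ i, Real.exp (u i * y i - u i ^ 2 / 2) := by
  rw [likelihoodRatio, ← Real.exp_sum, Finset.sum_sub_distrib, ← Finset.sum_div,
    EuclideanSpace.real_norm_sq_eq, PiLp.inner_apply]
  simp [mul_comm]

theorem likelihood_eq (lam : ℝ) (v y : Tensor d p) :
    likelihood lam v y = (∏ i, gaussianPDFReal 0 1 (y i)) * likelihoodRatio (√lam • v) y := by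
  rw [likelihoodRatio_eq_prod, likelihood, ← Finset.prod_mul_distrib]
  refine Finset.prod_congr rfl fun i _ => ?_
  simp only [gaussianPDFReal, PiLp.smul_apply, smul_eq_mul]
  rw [mul_assoc _ (Real.exp _), ← Real.exp_add]
  congr 2
  push_cast
  ring

instance isProbabilityMeasure_noise : IsProbabilityMeasure (noise d p) :=
  Measure.isProbabilityMeasure_map (by fun_prop)

theorem noise_map_add (u : Tensor d p) :
    (noise d p).map (fun z => u + z) =
      (noise d p).withDensity fun y => ENNReal.ofReal (likelihoodRatio u y) := by
  have hshift : (Measure.pi fun _ : Fin d → Fin p => gaussianReal 0 1).map (fun y i => u i + y i) =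
      Measure.pi fun i => gaussianReal (u i) 1 := by
    have hmap (i) : (gaussianReal 0 1).map (fun y => u i + y) = gaussianReal (u i) 1 := by
      rw [gaussianReal_map_const_add, zero_add]
    have hprob (i) : IsProbabilityMeasure ((gaussianReal 0 1).map fun y => u i + y) := by
      rw [hmap]
      infer_instance
    rw [Measure.pi_map_pi (μ := fun _ => gaussianReal 0 1) (f := fun i y => u i + y)
      fun i => by fun_prop]
    exact congrArg Measure.pi (funext hmap)
  have hmeas : Measurable fun y : Tensor d p => ENNReal.ofReal (likelihoodRatio u y) :=
    (continuous_likelihoodRatio u).measurable.ennreal_ofReal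
  have hcomm : (fun z : Tensor d p => u + z) ∘ WithLp.toLp 2 =
      WithLp.toLp 2 ∘ fun (y : (Fin d → Fin p) → ℝ) i => u i + y i := rfl
  have htoLp : Measurable (WithLp.toLp 2 : ((Fin d → Fin p) → ℝ) → Tensor d p) := by fun_prop
  rw [noise, Measure.map_map (by fun_prop) htoLp, hcomm,
    ← Measure.map_map htoLp (by fun_prop), hshift, pi_gaussianReal_eq_withDensity]
  ext s hs
  rw [Measure.map_apply htoLp hs, withDensity_apply _ (htoLp hs), withDensity_apply _ hs,
    setLIntegral_map hs hmeas htoLp]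
  refine lintegral_congr fun y => ?_
  rw [likelihoodRatio_eq_prod, ENNReal.ofReal_prod_of_nonneg fun i _ => (Real.exp_pos _).le]

theorem noise_add_mem (u : Tensor d p) {s : Set (Tensor d p)} (hs : MeasurableSet s) :
    noise d p {z | u + z ∈ s} = ∫⁻ y in s, ENNReal.ofReal (likelihoodRatio u y) ∂(noise d p) := by
  rw [← withDensity_apply _ hs, ← noise_map_add, Measure.map_apply (by fun_prop) hs]
  rfl

/-- The translated noise law has total mass one; this normalization is the moment generating
function. -/
theorem lintegral_exp_inner_noise (u : Tensor d p) :
    ∫⁻ z, ENNReal.ofReal (Real.exp (inner ℝ u z)) ∂(noise d p) =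
      ENNReal.ofReal (Real.exp (‖u‖ ^ 2 / 2)) := by
  have h1 : ∫⁻ y, ENNReal.ofReal (likelihoodRatio u y) ∂(noise d p) = 1 := by
    simpa using (noise_add_mem u MeasurableSet.univ).symm
  rw [← mul_one (ENNReal.ofReal (Real.exp (‖u‖ ^ 2 / 2))), ← h1,
    ← lintegral_const_mul' _ _ ENNReal.ofReal_ne_top]
  refine lintegral_congr fun y => ?_
  rw [likelihoodRatio, ← ENNReal.ofReal_mul (by positivity), ← Real.exp_add]
  ring_nf

/-- The Chernoff bound for a linear functional of the noise. -/
theorem noise_le_inner (u : Tensor d p) (c : ℝ) :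
    noise d p {z | c ≤ inner ℝ u z} ≤ ENNReal.ofReal (Real.exp (‖u‖ ^ 2 / 2 - c)) := by
  have h := meas_ge_le_lintegral_div (μ := noise d p)
    (f := fun z => ENNReal.ofReal (Real.exp (inner ℝ u z))) (by fun_prop)
    (ε := ENNReal.ofReal (Real.exp c)) (by simp [Real.exp_pos]) ENNReal.ofReal_ne_top
  rw [lintegral_exp_inner_noise, ← ENNReal.ofReal_div_of_pos (Real.exp_pos c), ← Real.exp_sub] at h
  refine (measure_mono fun z hz => ?_).trans h
  exact ENNReal.ofReal_le_ofReal (Real.exp_le_exp.2 hz)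

/-! ### Signals indexed by supports -/

/-- The vector with support `S` and all nonzero entries equal to `m^{-1/2}`. -/
noncomputable def codeword {ι : Type} [DecidableEq ι] (m : ℕ) (S : Finset ι) : EuclideanSpace ℝ ι :=
  WithLp.toLp 2 fun i => if i ∈ S then (√(m : ℝ))⁻¹ else 0

section Codeword

variable {ι : Type} [DecidableEq ι]

theorem codeword_apply (m : ℕ) (S : Finset ι) (i : ι) :
    codeword m S i = if i ∈ S then (√(m : ℝ))⁻¹ else 0 := rfl

theorem codeword_nonneg (m : ℕ) (S : Finset ι) (i : ι) : 0 ≤ codeword m S i := by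
  rw [codeword_apply]
  split_ifs <;> positivity

theorem codeword_injective {m : ℕ} (hm : 1 ≤ m) :
    Function.Injective (codeword m : Finset ι → EuclideanSpace ℝ ι) := by
  intro S T h
  have hm' : (√(m : ℝ))⁻¹ ≠ 0 := by positivity
  ext i
  have hi := congrArg (fun v : EuclideanSpace ℝ ι => v i) h
  simp only [codeword_apply] at hi
  by_cases hS : i ∈ S <;> by_cases hT : i ∈ T <;> simp only [hS, hT, if_true, if_false] at hi ⊢
  exacts [absurd hi hm', absurd hi.symm hm']

variable [Fintype ι]

theorem inner_codeword (m : ℕ) (S T : Finset ι) :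
    inner ℝ (codeword m S) (codeword m T) = ((S ∩ T).card : ℝ) / m := by
  have hm : (√(m : ℝ))⁻¹ * (√(m : ℝ))⁻¹ = (m : ℝ)⁻¹ := by
    rw [← mul_inv, Real.mul_self_sqrt (Nat.cast_nonneg m)]
  have h (i : ι) : codeword m S i * codeword m T i = if i ∈ S ∩ T then (m : ℝ)⁻¹ else 0 := by
    simp only [codeword_apply, Finset.mem_inter]
    by_cases hS : i ∈ S <;> by_cases hT : i ∈ T <;> simp [hS, hT, hm]
  simp only [PiLp.inner_apply, RCLike.inner_apply, conj_trivial]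
  rw [Finset.sum_congr rfl fun i _ => (mul_comm _ _).trans (h i), Finset.sum_ite_mem,
    Finset.univ_inter, Finset.sum_const, nsmul_eq_mul, div_eq_mul_inv]

theorem norm_sq_codeword (m : ℕ) (S : Finset ι) : ‖codeword m S‖ ^ 2 = (S.card : ℝ) / m := by
  rw [← real_inner_self_eq_norm_sq, inner_codeword, Finset.inter_self]

theorem binarySphere_eq {m : ℕ} (hm : 1 ≤ m) :
    binarySphere ι m =
      (((Finset.univ : Finset ι).powersetCard m).image (codeword m) : Finset _) := by
  have hm0 : (m : ℝ) ≠ 0 := by positivity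
  ext v
  simp only [binarySphere, Set.mem_ofPred_eq, Finset.coe_image, Set.mem_image, Finset.mem_coe,
    Finset.mem_powersetCard_univ]
  constructor
  · rintro ⟨hv, hnorm⟩
    have hv' : codeword m (Finset.univ.filter fun i => v i ≠ 0) = v := by
      ext i
      rw [codeword_apply]
      rcases hv i with h | h
      · simp [h]
      · simp [h, hm0]
    refine ⟨_, ?_, hv'⟩
    have := norm_sq_codeword m (Finset.univ.filter fun i => v i ≠ 0)
    rw [hv', hnorm, one_pow, eq_div_iff hm0, one_mul] at this
    exact_mod_cast this.symm
  · rintro ⟨S, hS, rfl⟩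
    refine ⟨fun i => ?_, ?_⟩
    · rw [codeword_apply]
      split_ifs <;> simp
    · rw [← sq_eq_sq₀ (norm_nonneg _) zero_le_one, norm_sq_codeword, hS, div_self hm0, one_pow]

end Codeword

theorem inner_tensorPow (d : ℕ) {p : ℕ} (x y : EuclideanSpace ℝ (Fin p)) :
    inner ℝ (tensorPow d x) (tensorPow d y) = inner ℝ x y ^ d := by
  simp only [PiLp.inner_apply, RCLike.inner_apply, conj_trivial, tensorPow]
  rw [← Fin.prod_const, Finset.prod_univ_sum, Fintype.piFinset_univ]
  exact Finset.sum_congr rfl fun i _ => Finset.prod_mul_distrib.symm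

theorem norm_tensorPow (d : ℕ) {p : ℕ} (x : EuclideanSpace ℝ (Fin p)) :
    ‖tensorPow d x‖ = ‖x‖ ^ d := by
  rw [← sq_eq_sq₀ (norm_nonneg _) (by positivity), ← real_inner_self_eq_norm_sq, inner_tensorPow,
    real_inner_self_eq_norm_sq, ← pow_mul, ← pow_mul, mul_comm]

theorem continuous_tensorPow (d p : ℕ) :
    Continuous (tensorPow d : EuclideanSpace ℝ (Fin p) → Tensor d p) := by
  unfold tensorPow
  fun_prop

theorem signalSet_subset_binarySphere (d p k : ℕ) :
    signalSet d p k ⊆ binarySphere (Fin d → Fin p) (k ^ d) := by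
  rintro _ ⟨x, ⟨hx, hnorm⟩, rfl⟩
  refine ⟨fun i => ?_, by rw [norm_tensorPow, hnorm, one_pow]⟩
  by_cases h : ∃ j, x (i j) = 0
  · obtain ⟨j, hj⟩ := h
    exact .inl (Finset.prod_eq_zero (Finset.mem_univ j) hj)
  · push Not at h
    right
    have hsqrt : √((k ^ d : ℕ) : ℝ) = √(k : ℝ) ^ d := by
      rw [Nat.cast_pow, Real.sqrt_eq_iff_mul_self_eq (by positivity) (by positivity), ← mul_pow,
        Real.mul_self_sqrt (Nat.cast_nonneg k)]
    rw [hsqrt, ← inv_pow, ← Fin.prod_const]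
    change ∏ j, x (i j) = _
    exact Finset.prod_congr rfl fun j _ => (hx (i j)).resolve_left (h j)

theorem binarySphere_subset_closedBall (ι : Type) [Fintype ι] (m : ℕ) :
    binarySphere ι m ⊆ Metric.closedBall 0 1 := fun v hv => by
  rw [mem_closedBall_zero_iff, hv.2]

/-- The signal `x^{⊗ d}`, where `x` has support `S`. -/
noncomputable def signal (d : ℕ) {p : ℕ} (k : ℕ) (S : Finset (Fin p)) : Tensor d p :=
  tensorPow d (codeword k S)

/-- The diagonal entries are the `d`-th powers of the coordinates, and nonnegativity makes the power
injective even for even `d`. -/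
theorem signal_injective {d p k : ℕ} (hd : d ≠ 0) (hk : 1 ≤ k) :
    Function.Injective (signal d k : Finset (Fin p) → Tensor d p) := by
  intro S T h
  refine codeword_injective hk ?_
  ext i
  have hi := congrArg (fun v : Tensor d p => v fun _ => i) h
  simp only [signal, tensorPow, Fin.prod_const] at hi
  exact (pow_left_inj₀ (codeword_nonneg k S i) (codeword_nonneg k T i) hd).1 hi

theorem inner_signal (d : ℕ) {p : ℕ} (k : ℕ) (S T : Finset (Fin p)) :
    inner ℝ (signal d k S) (signal d k T) = (((S ∩ T).card : ℝ) / k) ^ d := by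
  rw [signal, signal, inner_tensorPow, inner_codeword]

theorem norm_signal {d p k : ℕ} (hk : 1 ≤ k) {S : Finset (Fin p)} (hS : S.card = k) :
    ‖signal d k S‖ = 1 := by
  have hk0 : (k : ℝ) ≠ 0 := by positivity
  rw [← sq_eq_sq₀ (norm_nonneg _) zero_le_one, ← real_inner_self_eq_norm_sq, inner_signal,
    Finset.inter_self, hS, div_self hk0, one_pow, one_pow]

theorem mem_signalSet {d p k : ℕ} (hk : 1 ≤ k) {v : Tensor d p} :
    v ∈ signalSet d p k ↔ ∃ S : Finset (Fin p), S.card = k ∧ signal d k S = v := by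
  simp [signalSet, binarySphere_eq hk, signal]

/-! ### Optimality of maximum likelihood -/

variable {k : ℕ} {lam : ℝ} {Xhat : Tensor d p → Tensor d p}

theorem errorProb_eq_sum (hk : 1 ≤ k) (hX : Measurable Xhat) :
    errorProb d p k lam Xhat = (p.choose k : ℝ)⁻¹ * ∑ S ∈ (Finset.univ : Finset (Fin p)).powersetCard k,
      (noise d p).real {z | Xhat (√lam • signal d k S + z) ≠ signal d k S} := by
  have hA : MeasurableSet {ω : Tensor d p × Tensor d p |
      Xhat (observation lam ω.1 ω.2) ≠ ω.1} := by
    refine (measurableSet_eq_fun (f := fun ω : Tensor d p × Tensor d p =>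
      Xhat (observation lam ω.1 ω.2)) (hX.comp ?_) measurable_fst).compl
    unfold observation
    fun_prop
  have htp := (continuous_tensorPow d p).measurable
  rw [errorProb, measureReal_def, Measure.prod_apply hA, prior,
    lintegral_map (measurable_measure_prodMk_left hA) htp, binarySphere_eq hk, uniformOn,
    ProbabilityTheory.cond, lintegral_smul_measure, lintegral_finset,
    Finset.sum_image (codeword_injective hk).injOn, Measure.count_apply_finset,
    Finset.card_image_of_injective _ (codeword_injective hk), Finset.card_powersetCard,
    Finset.card_univ, Fintype.card_fin, smul_eq_mul, ENNReal.toReal_mul, ENNReal.toReal_inv,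
    ENNReal.toReal_natCast, ENNReal.toReal_sum]
  · congr 1
    refine Finset.sum_congr rfl fun S _ => ?_
    rw [Measure.count_singleton, mul_one]
    rfl
  · intro S _
    rw [Measure.count_singleton, mul_one]
    exact measure_ne_top _ _

theorem errorProb_eq_one_sub (hk : 1 ≤ k) (hkp : k ≤ p) (hX : Measurable Xhat) :
    errorProb d p k lam Xhat =
      1 - (p.choose k : ℝ)⁻¹ * ∑ S ∈ (Finset.univ : Finset (Fin p)).powersetCard k,
        (noise d p).real {z | √lam • signal d k S + z ∈ Xhat ⁻¹' {signal d k S}} := by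
  have hM : (p.choose k : ℝ) ≠ 0 := by exact_mod_cast (Nat.choose_pos hkp).ne'
  rw [errorProb_eq_sum hk hX]
  have h (S : Finset (Fin p)) :
      (noise d p).real {z | Xhat (√lam • signal d k S + z) ≠ signal d k S} =
        1 - (noise d p).real {z | √lam • signal d k S + z ∈ Xhat ⁻¹' {signal d k S}} := by
    rw [← probReal_compl_eq_one_sub]
    · rfl
    · have : Measurable fun z => √lam • signal d k S + z := by fun_prop
      exact this (hX (measurableSet_singleton _))
  rw [Finset.sum_congr rfl fun S _ => h S, Finset.sum_sub_distrib, mul_sub]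
  congr 1
  rw [Finset.sum_const, Finset.card_powersetCard, Finset.card_univ, Fintype.card_fin, nsmul_eq_mul,
    mul_one, inv_mul_cancel₀ hM]

/-- Moving every success probability to the common noise law lets two estimators be compared
pointwise in `y`. -/
theorem sum_noise_correct_eq (hX : Measurable Xhat) (F : Finset (Finset (Fin p))) :
    ∑ S ∈ F, noise d p {z | √lam • signal d k S + z ∈ Xhat ⁻¹' {signal d k S}} =
      ∫⁻ y, ∑ S ∈ F, (Xhat ⁻¹' {signal d k S}).indicator
        (fun y => ENNReal.ofReal (likelihoodRatio (√lam • signal d k S) y)) y ∂(noise d p) := by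
  have hs (S : Finset (Fin p)) : MeasurableSet (Xhat ⁻¹' {signal d k S}) :=
    hX (measurableSet_singleton _)
  have hL (S : Finset (Fin p)) : Measurable fun y : Tensor d p =>
      ENNReal.ofReal (likelihoodRatio (√lam • signal d k S) y) :=
    (continuous_likelihoodRatio _).measurable.ennreal_ofReal
  rw [lintegral_finsetSum _ fun S _ => (hL S).indicator (hs S)]
  refine Finset.sum_congr rfl fun S _ => ?_
  rw [noise_add_mem _ (hs S), lintegral_indicator (hs S)]

theorem prod_gaussianPDFReal_pos (y : Tensor d p) : 0 < ∏ i, gaussianPDFReal 0 1 (y i) :=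
  Finset.prod_pos fun _ _ => gaussianPDFReal_pos 0 1 _ one_ne_zero

/-- No estimator beats a maximum-likelihood estimator. -/
theorem IsMLE.errorProb_le (hd : d ≠ 0) (hk : 1 ≤ k) (hkp : k ≤ p)
    {Xmle : Tensor d p → Tensor d p} (hmle : IsMLE d p k lam Xmle) (hX : Measurable Xhat) :
    errorProb d p k lam Xmle ≤ errorProb d p k lam Xhat := by
  rw [errorProb_eq_one_sub hk hkp hX, errorProb_eq_one_sub hk hkp hmle.1]
  refine sub_le_sub_left (mul_le_mul_of_nonneg_left ?_ (by positivity)) _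
  simp only [measureReal_def]
  rw [← ENNReal.toReal_sum fun S _ => measure_ne_top _ _,
    ← ENNReal.toReal_sum fun S _ => measure_ne_top _ _]
  refine ENNReal.toReal_mono (ENNReal.sum_ne_top.2 fun S _ => measure_ne_top _ _) ?_
  rw [sum_noise_correct_eq hX, sum_noise_correct_eq hmle.1]
  refine lintegral_mono fun y => ?_
  obtain ⟨hmem, hmax⟩ := hmle.2 y
  obtain ⟨T, hT, hTy⟩ := (mem_signalSet hk).1 hmem
  have hTF : T ∈ (Finset.univ : Finset (Fin p)).powersetCard k := Finset.mem_powersetCard_univ.2 hT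
  have hle : ∀ S ∈ (Finset.univ : Finset (Fin p)).powersetCard k,
      likelihoodRatio (√lam • signal d k S) y ≤ likelihoodRatio (√lam • signal d k T) y := by
    intro S hS
    have := hmax _ ((mem_signalSet hk).2 ⟨S, Finset.mem_powersetCard_univ.1 hS, rfl⟩)
    rw [likelihood_eq, likelihood_eq, ← hTy] at this
    exact le_of_mul_le_mul_left this (prod_gaussianPDFReal_pos y)
  calc ∑ S ∈ (Finset.univ : Finset (Fin p)).powersetCard k, (Xhat ⁻¹' {signal d k S}).indicator
        (fun y => ENNReal.ofReal (likelihoodRatio (√lam • signal d k S) y)) y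
      ≤ ENNReal.ofReal (likelihoodRatio (√lam • signal d k T) y) := by
        -- An estimate equals at most one signal, so at most one indicator is nonzero.
        by_cases h : ∃ S ∈ (Finset.univ : Finset (Fin p)).powersetCard k, Xhat y = signal d k S
        · obtain ⟨S, hS, hSy⟩ := h
          rw [Finset.sum_eq_single_of_mem S hS]
          · exact (Set.indicator_le_self _ _ _).trans (ENNReal.ofReal_le_ofReal (hle S hS))
          · intro S' _ hne
            refine Set.indicator_of_notMem (fun hmem' => hne ?_) _
            exact signal_injective hd hk ((Set.mem_singleton_iff.1 hmem').symm.trans hSy)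
        · push Not at h
          rw [Finset.sum_eq_zero]
          · exact zero_le
          · intro S hS
            refine Set.indicator_of_notMem ?_ _
            exact h S hS
    _ = (Xmle ⁻¹' {signal d k T}).indicator
        (fun y => ENNReal.ofReal (likelihoodRatio (√lam • signal d k T) y)) y := by
        rw [Set.indicator_of_mem]
        exact hTy.symm
    _ ≤ _ := Finset.single_le_sum (f := fun S => (Xmle ⁻¹' {signal d k S}).indicator
        (fun y => ENNReal.ofReal (likelihoodRatio (√lam • signal d k S) y)) y)
        (fun _ _ => zero_le) hTF

theorem IsMLE.errorProb_eq_minErrorProb (hd : d ≠ 0) (hk : 1 ≤ k) (hkp : k ≤ p)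
    (hmle : IsMLE d p k lam Xhat) {A : Set (Tensor d p)} (hA : signalSet d p k ⊆ A) :
    errorProb d p k lam Xhat = minErrorProb d p k A lam := by
  have hleast : IsLeast (errorProb d p k lam '' {X | Measurable X ∧ ∀ y, X y ∈ A})
      (errorProb d p k lam Xhat) := by
    refine ⟨Set.mem_image_of_mem _ ⟨hmle.1, fun y => hA (hmle.2 y).1⟩, ?_⟩
    rintro _ ⟨X, ⟨hX, -⟩, rfl⟩
    exact hmle.errorProb_le hd hk hkp hX
  exact hleast.csInf_eq.symm

theorem IsMLE.errorProb_eq_MEP (hd : d ≠ 0) (hk : 1 ≤ k) (hkp : k ≤ p)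
    (hmle : IsMLE d p k lam Xhat) : errorProb d p k lam Xhat = MEP d p k lam :=
  hmle.errorProb_eq_minErrorProb hd hk hkp
    ((signalSet_subset_binarySphere d p k).trans (binarySphere_subset_closedBall _ _))

theorem IsMLE.errorProb_eq_CMEP (hd : d ≠ 0) (hk : 1 ≤ k) (hkp : k ≤ p)
    (hmle : IsMLE d p k lam Xhat) : errorProb d p k lam Xhat = CMEP d p k lam :=
  hmle.errorProb_eq_minErrorProb hd hk hkp (signalSet_subset_binarySphere d p k)

/-- A measurable choice of a maximizer over a finite set of parameters. -/
theorem exists_measurable_argmax {α β : Type*} [MeasurableSpace α] [MeasurableSpace β]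
    {L : β → α → ℝ} (hL : Measurable fun q : β × α => L q.1 q.2) (F : Finset β)
    (hF : F.Nonempty) :
    ∃ f : α → β, Measurable f ∧ ∀ y, f y ∈ F ∧ ∀ v ∈ F, L v y ≤ L (f y) y := by
  classical
  induction hF using Finset.Nonempty.cons_induction with
  | singleton a => exact ⟨fun _ => a, measurable_const, fun y => by simp⟩
  | cons a s ha hs ih =>
    obtain ⟨f, hf, hmax⟩ := ih
    refine ⟨fun y => if L (f y) y ≤ L a y then a else f y, ?_, fun y => ?_⟩
    · refine Measurable.ite (measurableSet_le ?_ ?_) measurable_const hf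
      · exact hL.comp (hf.prodMk measurable_id)
      · exact hL.comp (measurable_const.prodMk measurable_id)
    · obtain ⟨hmem, hle⟩ := hmax y
      simp only [Finset.mem_cons, forall_eq_or_imp]
      split_ifs with h
      · exact ⟨.inl rfl, le_rfl, fun v hv => (hle v hv).trans h⟩
      · exact ⟨.inr hmem, (not_le.1 h).le, hle⟩

theorem exists_isMLE (d : ℕ) (hk : 1 ≤ k) (hkp : k ≤ p) (lam : ℝ) :
    ∃ Xhat, IsMLE d p k lam Xhat := by
  have hL : Measurable fun q : Tensor d p × Tensor d p => likelihood lam q.1 q.2 := by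
    unfold likelihood gaussianPDFReal
    fun_prop
  obtain ⟨f, hf, hmax⟩ := exists_measurable_argmax hL
    (((Finset.univ : Finset (Fin p)).powersetCard k).image (signal d k))
    ((Finset.powersetCard_nonempty.2 (by simpa using hkp)).image _)
  have hset : ∀ v, v ∈ ((Finset.univ : Finset (Fin p)).powersetCard k).image (signal d k) ↔
      v ∈ signalSet d p k := by
    intro v
    simp [mem_signalSet hk]
  simp only [hset] at hmax
  exact ⟨f, hf, hmax⟩

/-! ### Converse by change of measure -/

theorem noise_real_le_inner (u : Tensor d p) (c : ℝ) :
    (noise d p).real {z | c ≤ inner ℝ u z} ≤ Real.exp (‖u‖ ^ 2 / 2 - c) :=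
  ENNReal.toReal_le_of_le_ofReal (Real.exp_pos _).le (noise_le_inner u c)

/-- Change of measure: the probability of `A` under `N(√lam v, 1)` is at most `exp γ` times its
probability under `N(0, 1)`, up to the probability that the likelihood ratio exceeds `exp γ`. -/
theorem noise_add_mem_le (hlam : 0 ≤ lam) {v : Tensor d p} (hv : ‖v‖ = 1) {A : Set (Tensor d p)}
    (hA : MeasurableSet A) (γ : ℝ) {s : ℝ} (hs : 0 ≤ s) :
    (noise d p).real {z | √lam • v + z ∈ A} ≤
      Real.exp γ * (noise d p).real A + Real.exp (s ^ 2 * lam / 2 - s * (γ - lam / 2)) := by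
  set B : Set (Tensor d p) := {y | likelihoodRatio (√lam • v) y ≤ Real.exp γ}
  have hB : MeasurableSet B :=
    measurableSet_le (continuous_likelihoodRatio _).measurable measurable_const
  have hsq : √lam * √lam = lam := Real.mul_self_sqrt hlam
  have hnorm : ‖√lam • v‖ ^ 2 = lam := by
    rw [norm_smul, hv, mul_one, Real.norm_of_nonneg (Real.sqrt_nonneg _), Real.sq_sqrt hlam]
  -- At `√lam v + z` the log-likelihood ratio is `lam / 2 + √lam ⟨v, z⟩`, so leaving `B` is a linear
  -- tail event; `s` is its Chernoff parameter.
  have hsub : {z | √lam • v + z ∈ A} ⊆ {z | √lam • v + z ∈ A ∩ B} ∪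
      {z | s * (γ - lam / 2) ≤ inner ℝ (s • √lam • v) z} := by
    intro z hz
    by_cases h : √lam • v + z ∈ B
    · exact .inl ⟨hz, h⟩
    · right
      have h' : Real.exp γ < likelihoodRatio (√lam • v) (√lam • v + z) := lt_of_not_ge h
      rw [likelihoodRatio, Real.exp_lt_exp, inner_add_right, real_inner_self_eq_norm_sq,
        hnorm] at h'
      change _ ≤ inner ℝ (s • √lam • v) z
      rw [real_inner_smul_left]
      exact mul_le_mul_of_nonneg_left (by linarith) hs
  have h1 : (noise d p).real {z | √lam • v + z ∈ A ∩ B} ≤ Real.exp γ * (noise d p).real A := by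
    refine ENNReal.toReal_le_of_le_ofReal (by positivity) ?_
    rw [noise_add_mem _ (hA.inter hB), ENNReal.ofReal_mul (Real.exp_pos _).le,
      ofReal_measureReal]
    calc ∫⁻ y in A ∩ B, ENNReal.ofReal (likelihoodRatio (√lam • v) y) ∂(noise d p)
        ≤ ∫⁻ _ in A ∩ B, ENNReal.ofReal (Real.exp γ) ∂(noise d p) :=
          setLIntegral_mono measurable_const fun y hy => ENNReal.ofReal_le_ofReal hy.2
      _ = ENNReal.ofReal (Real.exp γ) * noise d p (A ∩ B) := setLIntegral_const _ _
      _ ≤ _ := by gcongr; exact Set.inter_subset_left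
  have h2 := noise_real_le_inner (s • √lam • v) (s * (γ - lam / 2))
  rw [norm_smul, mul_pow, hnorm, Real.norm_of_nonneg hs] at h2
  exact (measureReal_mono hsub).trans ((measureReal_union_le _ _).trans (add_le_add h1 h2))

/-- The strong converse, for a fixed number of signals. -/
theorem one_sub_le_errorProb (hd : d ≠ 0) (hk : 1 ≤ k) (hkp : k ≤ p) (hlam : 0 ≤ lam)
    (hX : Measurable Xhat) (γ : ℝ) {s : ℝ} (hs : 0 ≤ s) :
    1 - (Real.exp γ / p.choose k + Real.exp (s ^ 2 * lam / 2 - s * (γ - lam / 2))) ≤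
      errorProb d p k lam Xhat := by
  have hM : (0 : ℝ) < p.choose k := by exact_mod_cast Nat.choose_pos hkp
  rw [errorProb_eq_one_sub hk hkp hX]
  refine sub_le_sub_left ?_ 1
  have hmeas (S : Finset (Fin p)) : MeasurableSet (Xhat ⁻¹' {signal d k S}) :=
    hX (measurableSet_singleton _)
  have hdisj : ∑ S ∈ (Finset.univ : Finset (Fin p)).powersetCard k,
      (noise d p).real (Xhat ⁻¹' {signal d k S}) ≤ 1 := by
    rw [← measureReal_biUnion_finset _ fun S _ => hmeas S]
    · exact measureReal_le_one
    · intro S _ T _ hST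
      refine Set.disjoint_left.2 fun y hS hT => hST ?_
      exact signal_injective hd hk ((Set.mem_singleton_iff.1 hS).symm.trans hT)
  have hsum := Finset.sum_le_sum fun S (hS : S ∈ (Finset.univ : Finset (Fin p)).powersetCard k) =>
    noise_add_mem_le hlam (norm_signal (d := d) hk (Finset.mem_powersetCard_univ.1 hS)) (hmeas S) γ hs
  rw [Finset.sum_add_distrib, ← Finset.mul_sum, Finset.sum_const, Finset.card_powersetCard,
    Finset.card_univ, Fintype.card_fin, nsmul_eq_mul] at hsum
  rw [inv_mul_le_iff₀ hM, mul_add, mul_div_cancel₀ _ hM.ne']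
  exact hsum.trans (by gcongr; exact mul_le_of_le_one_right (Real.exp_pos _).le hdisj)

/-! ### Achievability by a conditioned union bound -/

/-- Group `T` by `A = S ∩ T`, a proper subset of `S`: there are at most `2 ^ k` groups, each
contributing at most `(p * q) ^ (k - A.card) ≤ p * q`. -/
theorem sum_pow_card_sdiff_le (S : Finset (Fin p)) (hS : S.card = k) {q : ℝ} (hq : 0 ≤ q)
    (hpq : p * q ≤ 1) :
    ∑ T ∈ ((Finset.univ : Finset (Fin p)).powersetCard k).erase S, q ^ (k - (S ∩ T).card) ≤
      2 ^ k * (p * q) := by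
  set F := ((Finset.univ : Finset (Fin p)).powersetCard k).erase S
  have hmaps : ∀ T ∈ F, S ∩ T ∈ S.powerset.erase S := by
    intro T hT
    simp only [F, Finset.mem_erase, Finset.mem_powersetCard_univ] at hT
    refine Finset.mem_erase.2 ⟨fun h => hT.1 ?_, Finset.mem_powerset.2 Finset.inter_subset_left⟩
    exact (Finset.eq_of_subset_of_card_le (Finset.inter_eq_left.1 h) (by rw [hS, hT.2])).symm
  rw [← Finset.sum_fiberwise_of_maps_to hmaps]
  have hfiber : ∀ A ∈ S.powerset.erase S,
      ∑ T ∈ F with S ∩ T = A, q ^ (k - (S ∩ T).card) ≤ p * q := by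
    intro A hA
    obtain ⟨hne, hAS⟩ := Finset.mem_erase.1 hA
    have hAS := Finset.mem_powerset.1 hAS
    have hlt : A.card < k := hS ▸ Finset.card_lt_card (hAS.ssubset_of_ne hne)
    have hcard : (F.filter fun T => S ∩ T = A).card ≤ p.choose (k - A.card) := by
      -- Within a fibre, `T` is recovered from `T \ S`.
      have h := Finset.card_le_card_of_injOn (s := F.filter fun T => S ∩ T = A)
        (t := (Finset.univ : Finset (Fin p)).powersetCard (k - A.card)) (fun T => T \ S) ?_ ?_
      · simpa using h
      · intro T hT
        simp only [F, Finset.coe_filter, Finset.mem_erase, Finset.mem_powersetCard_univ,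
          Set.mem_ofPred_eq] at hT
        rw [Finset.mem_coe, Finset.mem_powersetCard_univ, Finset.card_sdiff, hT.1.2, hT.2]
      · intro T hT T' hT' h
        simp only [Finset.coe_filter, Set.mem_ofPred_eq] at hT hT' h
        rw [← Finset.sdiff_union_inter T S, ← Finset.sdiff_union_inter T' S, h,
          Finset.inter_comm T, Finset.inter_comm T', hT.2, hT'.2]
    calc ∑ T ∈ F with S ∩ T = A, q ^ (k - (S ∩ T).card)
        = (F.filter fun T => S ∩ T = A).card * q ^ (k - A.card) := by
          rw [Finset.sum_congr rfl fun T hT => by rw [(Finset.mem_filter.1 hT).2],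
            Finset.sum_const, nsmul_eq_mul]
      _ ≤ (p : ℝ) ^ (k - A.card) * q ^ (k - A.card) := by
          gcongr
          exact_mod_cast hcard.trans (Nat.choose_le_pow p _)
      _ ≤ p * q := by
          rw [← mul_pow]
          exact pow_le_of_le_one (by positivity) hpq (by omega)
  refine (Finset.sum_le_card_nsmul _ _ _ hfiber).trans ?_
  rw [nsmul_eq_mul]
  gcongr
  have := (Finset.card_erase_le (s := S.powerset) (a := S)).trans_eq (Finset.card_powerset S)
  rw [hS] at this
  exact_mod_cast this

/-- The pairwise error bound, on the event that the noise in the direction of the signal `v` is at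
least `-t`. -/
theorem noise_pairwise_le {v w : Tensor d p} (hv : ‖v‖ = 1) (hw : ‖w‖ = 1) {t : ℝ}
    (ht : t ≤ √lam) (hvw : 0 ≤ inner ℝ v w) :
    (noise d p).real {z | -t ≤ inner ℝ v z ∧
        inner ℝ v (√lam • v + z) ≤ inner ℝ w (√lam • v + z)} ≤
      Real.exp (-((√lam - t) ^ 2 / 2 * ((1 - inner ℝ v w) / (1 + inner ℝ v w)))) := by
  set ρ : ℝ := inner ℝ v w with hρ
  have hρ1 : ρ ≤ 1 := by simpa [hv, hw] using real_inner_le_norm v w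
  -- The optimal Chernoff parameter for `w - ρ • v`, the part of `w` orthogonal to `v`, of squared
  -- norm `1 - ρ ^ 2`.
  set a := (√lam - t) / (1 + ρ) with ha
  have ha0 : 0 ≤ a := div_nonneg (by linarith) (by linarith)
  have har : a * (1 + ρ) = √lam - t := div_mul_cancel₀ _ (by linarith)
  have hvv : inner ℝ v v = (1 : ℝ) := by rw [real_inner_self_eq_norm_sq, hv, one_pow]
  have hww : inner ℝ w w = (1 : ℝ) := by rw [real_inner_self_eq_norm_sq, hw, one_pow]
  have hwv : inner ℝ w v = ρ := real_inner_comm _ _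
  have hnorm : ‖a • (w - ρ • v)‖ ^ 2 = a ^ 2 * (1 - ρ ^ 2) := by
    rw [← real_inner_self_eq_norm_sq]
    simp only [inner_smul_left, inner_smul_right, inner_sub_left, inner_sub_right, conj_trivial,
      hvv, hww, hwv, ← hρ]
    ring
  have hsub : {z | -t ≤ inner ℝ v z ∧
        inner ℝ v (√lam • v + z) ≤ inner ℝ w (√lam • v + z)} ⊆
      {z | a * (1 - ρ) * (√lam - t) ≤ inner ℝ (a • (w - ρ • v)) z} := by
    rintro z ⟨hz1, hz2⟩
    rw [inner_add_right, inner_add_right, inner_smul_right, inner_smul_right, hvv, hwv] at hz2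
    change _ ≤ inner ℝ (a • (w - ρ • v)) z
    rw [inner_smul_left, inner_sub_left, inner_smul_left, conj_trivial, conj_trivial, mul_assoc]
    refine mul_le_mul_of_nonneg_left ?_ ha0
    nlinarith [mul_nonneg (sub_nonneg.2 hρ1) (neg_le_iff_add_nonneg.1 hz1)]
  refine (measureReal_mono hsub).trans ((noise_real_le_inner _ _).trans_eq ?_)
  rw [hnorm, ← har]
  congr 1
  field_simp
  ring

/-- For `d = 2`, clearing the denominator leaves `u * (1 - u) ^ 2 ≥ 0`, and larger `d` only
decreases `u ^ d`. At `d = 1` the bound fails for `0 < u < 1`. -/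
theorem one_sub_le_div {d : ℕ} (hd : 2 ≤ d) {u : ℝ} (hu0 : 0 ≤ u) (hu1 : u ≤ 1) :
    1 - u ≤ (1 - u ^ d) / (1 + u ^ d) := by
  have h0 : 0 ≤ u ^ d := by positivity
  have h2 : u ^ d ≤ u ^ 2 := pow_le_pow_of_le_one hu0 hu1 hd
  rw [le_div_iff₀ (by linarith)]
  nlinarith [mul_nonneg hu0 (sq_nonneg (1 - u)), mul_nonneg (sub_nonneg.2 h2) (by linarith : 0 ≤ 2 - u)]

theorem IsMLE.errorProb_le_of_gap (hd : 2 ≤ d) (hk : 1 ≤ k) (hkp : k ≤ p) (hlam : 0 < lam)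
    (hmle : IsMLE d p k lam Xhat) {t : ℝ} (ht0 : 0 ≤ t) (ht : t ≤ √lam)
    (hpq : p * Real.exp (-((√lam - t) ^ 2 / (2 * k))) ≤ 1) :
    errorProb d p k lam Xhat ≤
      Real.exp (-(t ^ 2 / 2)) + 2 ^ k * (p * Real.exp (-((√lam - t) ^ 2 / (2 * k)))) := by
  have hM : (0 : ℝ) < p.choose k := by exact_mod_cast Nat.choose_pos hkp
  have hk0 : (0 : ℝ) < k := by exact_mod_cast hk
  set q := Real.exp (-((√lam - t) ^ 2 / (2 * k))) with hq
  set F := (Finset.univ : Finset (Fin p)).powersetCard k with hF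
  have hS : ∀ S ∈ F, (noise d p).real {z | Xhat (√lam • signal d k S + z) ≠ signal d k S} ≤
      Real.exp (-(t ^ 2 / 2)) + 2 ^ k * (p * q) := by
    intro S hSF
    have hSk : S.card = k := Finset.mem_powersetCard_univ.1 hSF
    have hSnorm := norm_signal (d := d) hk hSk
    set v := signal d k S with hv
    have hsub : {z | Xhat (√lam • v + z) ≠ v} ⊆ {z | t ^ 2 ≤ inner ℝ (-t • v) z} ∪
        ⋃ T ∈ F.erase S, {z | -t ≤ inner ℝ v z ∧
          inner ℝ v (√lam • v + z) ≤ inner ℝ (signal d k T) (√lam • v + z)} := by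
      intro z hz
      by_cases hzt : -t ≤ inner ℝ v z
      · right
        obtain ⟨hmem, hmax⟩ := hmle.2 (√lam • v + z)
        obtain ⟨T, hTk, hT⟩ := (mem_signalSet hk).1 hmem
        have hle := hmax v ((mem_signalSet hk).2 ⟨S, hSk, rfl⟩)
        rw [likelihood_eq, likelihood_eq, ← hT] at hle
        have hle := Real.exp_le_exp.1 (le_of_mul_le_mul_left hle (prod_gaussianPDFReal_pos _))
        -- All signals have norm one, so maximizing likelihood is maximizing correlation with the
        -- observation.
        rw [norm_smul, norm_smul, norm_signal hk hTk, hSnorm, sub_le_sub_iff_right,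
          real_inner_smul_left, real_inner_smul_left] at hle
        refine Set.mem_biUnion (x := T) (Finset.mem_erase.2 ⟨?_, ?_⟩)
          ⟨hzt, le_of_mul_le_mul_left hle (Real.sqrt_pos.2 hlam)⟩
        · rintro rfl
          exact hz hT.symm
        · exact Finset.mem_powersetCard_univ.2 hTk
      · left
        change _ ≤ inner ℝ (-t • v) z
        rw [real_inner_smul_left]
        nlinarith [not_le.1 hzt]
    have hbad : (noise d p).real {z | t ^ 2 ≤ inner ℝ (-t • v) z} ≤ Real.exp (-(t ^ 2 / 2)) := by
      refine (noise_real_le_inner _ _).trans_eq ?_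
      rw [norm_smul, hSnorm, mul_one, norm_neg, Real.norm_eq_abs, sq_abs]
      ring_nf
    have hpair : ∀ T ∈ F.erase S, (noise d p).real {z | -t ≤ inner ℝ v z ∧
          inner ℝ v (√lam • v + z) ≤ inner ℝ (signal d k T) (√lam • v + z)} ≤
        q ^ (k - (S ∩ T).card) := by
      intro T hT
      have hTk : T.card = k := Finset.mem_powersetCard_univ.1 (Finset.mem_of_mem_erase hT)
      have hle : (S ∩ T).card ≤ k := hSk ▸ Finset.card_le_card Finset.inter_subset_left
      have hu1 : ((S ∩ T).card : ℝ) / k ≤ 1 := div_le_one_of_le₀ (by exact_mod_cast hle) hk0.le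
      have hinner : inner ℝ v (signal d k T) = (((S ∩ T).card : ℝ) / k) ^ d := inner_signal ..
      refine (noise_pairwise_le hSnorm (norm_signal hk hTk) ht
        (by rw [hinner]; positivity)).trans ?_
      rw [hinner, hq, ← Real.exp_nat_mul, Real.exp_le_exp, Nat.cast_sub hle]
      have := mul_le_mul_of_nonneg_left (one_sub_le_div hd (by positivity) hu1)
        (by positivity : 0 ≤ (√lam - t) ^ 2 / 2)
      refine (neg_le_neg this).trans_eq ?_
      field_simp
    calc (noise d p).real {z | Xhat (√lam • v + z) ≠ v}
        ≤ (noise d p).real {z | t ^ 2 ≤ inner ℝ (-t • v) z} + ∑ T ∈ F.erase S, (noise d p).real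
            {z | -t ≤ inner ℝ v z ∧
              inner ℝ v (√lam • v + z) ≤ inner ℝ (signal d k T) (√lam • v + z)} :=
          (measureReal_mono hsub).trans ((measureReal_union_le _ _).trans
            (add_le_add le_rfl (measureReal_biUnion_finset_le _ _)))
      _ ≤ _ := add_le_add hbad ((Finset.sum_le_sum hpair).trans
          (sum_pow_card_sdiff_le S hSk (Real.exp_pos _).le hpq))
  rw [errorProb_eq_sum hk hmle.1, inv_mul_le_iff₀ hM]
  refine (Finset.sum_le_card_nsmul _ _ _ hS).trans_eq ?_
  rw [hF, Finset.card_powersetCard, Finset.card_univ, Fintype.card_fin, nsmul_eq_mul]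

end Estimation

/-! ### Lower bounds for the number of signals -/

theorem pow_le_choose_mul_pow {p k : ℕ} (hkp : k ≤ p) : p ^ k ≤ p.choose k * k ^ k := by
  induction k generalizing p with
  | zero => simp
  | succ k ih =>
    obtain ⟨p, rfl⟩ : ∃ q, p = q + 1 := ⟨p - 1, by omega⟩
    have hkp' : k ≤ p := by omega
    have h : (p + 1) ^ k ≤ p.choose k * (k + 1) ^ k := by
      -- The factor `k ^ k` reduces the claim to `(p + 1) * k ≤ (k + 1) * p`, that is, `k ≤ p`; it
      -- is positive at `k = 0` too, as `0 ^ 0 = 1`.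
      refine Nat.le_of_mul_le_mul_right (c := k ^ k) ?_ Nat.pow_self_pos
      calc (p + 1) ^ k * k ^ k = ((p + 1) * k) ^ k := (mul_pow ..).symm
        _ ≤ ((k + 1) * p) ^ k := Nat.pow_le_pow_left (by nlinarith) k
        _ = (k + 1) ^ k * p ^ k := mul_pow ..
        _ ≤ (k + 1) ^ k * (p.choose k * k ^ k) := Nat.mul_le_mul_left _ (ih hkp')
        _ = p.choose k * (k + 1) ^ k * k ^ k := by ring
    calc (p + 1) ^ (k + 1) = (p + 1) ^ k * (p + 1) := pow_succ ..
      _ ≤ p.choose k * (k + 1) ^ k * (p + 1) := Nat.mul_le_mul_right _ h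
      _ = (p + 1) * p.choose k * (k + 1) ^ k := by ring
      _ = (p + 1).choose (k + 1) * (k + 1) ^ (k + 1) := by
        rw [Nat.add_one_mul_choose_eq]
        ring

theorem mul_log_sub_log_le_log_choose {p k : ℕ} (hk : 1 ≤ k) (hkp : k ≤ p) :
    k * (Real.log p - Real.log k) ≤ Real.log (p.choose k) := by
  have hM : (p.choose k : ℝ) ≠ 0 := by exact_mod_cast (Nat.choose_pos hkp).ne'
  have hk0 : (k : ℝ) ^ k ≠ 0 := by positivity
  have hp : (0 : ℝ) < (p : ℝ) ^ k := by
    have : 0 < p := by omega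
    positivity
  have h := Real.log_le_log hp (by exact_mod_cast pow_le_choose_mul_pow hkp :
    (p : ℝ) ^ k ≤ p.choose k * (k : ℝ) ^ k)
  rw [Real.log_mul hM hk0, Real.log_pow, Real.log_pow] at h
  linarith

/-! ### The two limits -/

section Asymptotics

variable {k : ℕ → ℕ}

theorem isLittleO_log_of_isLittleO_rpow {α : ℝ} (hα : α ≤ 1)
    (h : (fun p : ℕ => (k p : ℝ)) =o[atTop] fun p : ℕ => Real.log (p : ℝ) ^ α) :
    (fun p : ℕ => (k p : ℝ)) =o[atTop] fun p : ℕ => Real.log (p : ℝ) := by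
  refine h.trans_isBigO (IsBigO.of_bound 1 ?_)
  filter_upwards [(Real.tendsto_log_atTop.comp tendsto_natCast_atTop_atTop).eventually_ge_atTop 1]
    with p hp
  have hp : 1 ≤ Real.log p := hp
  rw [one_mul, Real.norm_of_nonneg (by positivity), Real.norm_of_nonneg (by linarith)]
  exact (Real.rpow_le_rpow_of_exponent_le hp hα).trans_eq (Real.rpow_one _)

theorem eventually_mul_le_log (hko : (fun p : ℕ => (k p : ℝ)) =o[atTop] fun p : ℕ => Real.log p)
    {c : ℝ} (hc : 0 < c) : ∀ᶠ p : ℕ in atTop, (k p : ℝ) ≤ c * Real.log p := by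
  filter_upwards [hko.bound hc, eventually_ge_atTop 1] with p hp hp1
  rwa [Real.norm_of_nonneg (Nat.cast_nonneg _), Real.norm_of_nonneg
    (Real.log_nonneg (by exact_mod_cast hp1))] at hp

theorem eventually_le_self (hko : (fun p : ℕ => (k p : ℝ)) =o[atTop] fun p : ℕ => Real.log p) :
    ∀ᶠ p : ℕ in atTop, k p ≤ p := by
  filter_upwards [eventually_mul_le_log hko one_pos] with p hp
  rw [one_mul] at hp
  exact_mod_cast hp.trans (Real.log_le_self (Nat.cast_nonneg p))

theorem tendsto_log_choose (hk : ∀ᶠ p in atTop, 1 ≤ k p)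
    (hko : (fun p : ℕ => (k p : ℝ)) =o[atTop] fun p : ℕ => Real.log p) :
    Tendsto (fun p : ℕ => Real.log (p.choose (k p))) atTop atTop := by
  have hlog : Tendsto (fun p : ℕ => Real.log p) atTop atTop :=
    Real.tendsto_log_atTop.comp tendsto_natCast_atTop_atTop
  refine tendsto_atTop_mono' _ ?_ (hlog.atTop_mul_const (by norm_num : (0 : ℝ) < 1 / 2))
  filter_upwards [hk, eventually_le_self hko,
    eventually_mul_le_log hko (by norm_num : (0 : ℝ) < 1 / 2), hlog.eventually_ge_atTop 0]
    with p hk1 hkp hkl hp0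
  have hk1' : (1 : ℝ) ≤ k p := by exact_mod_cast hk1
  have := Real.log_le_self (Nat.cast_nonneg (k p))
  have := mul_log_sub_log_le_log_choose hk1 hkp
  nlinarith

theorem tendsto_exp_neg_mul {f : ℕ → ℝ} (hf : Tendsto f atTop atTop) {c : ℝ} (hc : 0 < c) :
    Tendsto (fun p => Real.exp (-(c * f p))) atTop (𝓝 0) :=
  Real.tendsto_exp_neg_atTop_nhds_zero.comp (hf.const_mul_atTop hc)

/-- Below the critical signal-to-noise ratio, the error probability of every estimator tends to
one. -/
theorem eventually_le_errorProb {d : ℕ} (hd : d ≠ 0) (hk : ∀ᶠ p in atTop, 1 ≤ k p)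
    (hko : (fun p : ℕ => (k p : ℝ)) =o[atTop] fun p : ℕ => Real.log p) {β : ℝ} (hβ0 : 0 ≤ β)
    (hβ1 : β < 1) {c : ℝ} (hc : c < 1) :
    ∀ᶠ p in atTop, ∀ Xhat : Tensor d p → Tensor d p, Measurable Xhat →
      c ≤ errorProb d p (k p) (β * critSNR p (k p)) Xhat := by
  have hL := tendsto_log_choose hk hko
  have hlim := (tendsto_exp_neg_mul hL (by linarith : 0 < (1 - β) / 2)).add
    (tendsto_exp_neg_mul hL (by nlinarith : 0 < ((1 - β) / 4) ^ 2))
  rw [add_zero] at hlim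
  filter_upwards [hk, eventually_le_self hko, hL.eventually_ge_atTop 0,
    hlim.eventually_le_const (sub_pos.2 hc)] with p hk1 hkp hL0 hp Xhat hX
  set L := Real.log (p.choose (k p)) with hLdef
  have hM : (0 : ℝ) < p.choose (k p) := by exact_mod_cast Nat.choose_pos hkp
  have hlam : β * critSNR p (k p) = 2 * β * L := by
    rw [critSNR]
    ring
  rw [hlam]
  -- `γ` is the midpoint of `lam / 2 = β * L` and `L`. With `s = (1 - β) / 4` the tail exponent is
  -- `-(2 - β) * s ^ 2 * L`, at most `-s ^ 2 * L`.
  refine le_trans ?_ (one_sub_le_errorProb hd hk1 hkp (by positivity) hX ((1 + β) / 2 * L)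
    (by linarith : 0 ≤ (1 - β) / 4))
  have h1 : Real.exp ((1 + β) / 2 * L) / p.choose (k p) = Real.exp (-((1 - β) / 2 * L)) := by
    rw [← Real.exp_log hM, ← hLdef, ← Real.exp_sub]
    ring_nf
  have h2 : Real.exp (((1 - β) / 4) ^ 2 * (2 * β * L) / 2 -
      (1 - β) / 4 * ((1 + β) / 2 * L - 2 * β * L / 2)) ≤ Real.exp (-(((1 - β) / 4) ^ 2 * L)) := by
    rw [Real.exp_le_exp]
    nlinarith [mul_nonneg (mul_nonneg (sq_nonneg ((1 - β) / 4)) (sub_nonneg.2 hβ1.le)) hL0]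
  rw [h1]
  linarith

/-- Above the critical signal-to-noise ratio, the error probability of the maximum-likelihood
estimator tends to zero. -/
theorem exists_tendsto_zero_errorProb_le {d : ℕ} (hd : 2 ≤ d) (hk : ∀ᶠ p in atTop, 1 ≤ k p)
    (hko : (fun p : ℕ => (k p : ℝ)) =o[atTop] fun p : ℕ => Real.log p) {β : ℝ} (hβ : 1 < β) :
    ∃ b : ℕ → ℝ, Tendsto b atTop (𝓝 0) ∧ ∀ᶠ p in atTop, ∀ Xhat : Tensor d p → Tensor d p,
      IsMLE d p (k p) (β * critSNR p (k p)) Xhat →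
        errorProb d p (k p) (β * critSNR p (k p)) Xhat ≤ b p := by
  have hL := tendsto_log_choose hk hko
  have hlog : Tendsto (fun p : ℕ => Real.log p) atTop atTop :=
    Real.tendsto_log_atTop.comp tendsto_natCast_atTop_atTop
  -- The gap from `β` to `β'` pays for the noise along the signal, and that from `β'` to `1` for the
  -- union bound.
  obtain ⟨β', hβ'1, hβ'⟩ := exists_between hβ
  have hgap : 0 < √β - √β' := sub_pos.2 (Real.sqrt_lt_sqrt (by linarith) hβ')
  have hc : 0 < (β' - 1) / 2 := by linarith
  refine ⟨fun p => Real.exp (-((√β - √β') ^ 2 * Real.log (p.choose (k p)))) +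
    Real.exp (-((β' - 1) / 2 * Real.log p)), ?_, ?_⟩
  · simpa using (tendsto_exp_neg_mul hL (by positivity : 0 < (√β - √β') ^ 2)).add
      (tendsto_exp_neg_mul hlog hc)
  filter_upwards [hk, eventually_le_self hko, hL.eventually_gt_atTop 0, hlog.eventually_ge_atTop 0,
    eventually_mul_le_log hko (by positivity : 0 < (β' - 1) / 2 / (1 + β'))]
    with p hk1 hkp hL0 hp0 hkl Xhat hmle
  have hlower := mul_log_sub_log_le_log_choose hk1 hkp
  set L := Real.log (p.choose (k p)) with hLdef
  have hk0 : (0 : ℝ) < k p := by exact_mod_cast hk1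
  have hp : (0 : ℝ) < p := by exact_mod_cast hk1.trans hkp
  have hlam : β * critSNR p (k p) = β * (2 * L) := rfl
  rw [hlam] at hmle ⊢
  have hsqrt : √(β * (2 * L)) = √β * √(2 * L) := Real.sqrt_mul (by linarith) _
  have h2L : √(2 * L) ^ 2 = 2 * L := Real.sq_sqrt (by linarith)
  -- Chosen so that `√lam - t = √β' * √(2 * L)`, while `t` still tends to infinity.
  set t := (√β - √β') * √(2 * L) with ht
  have hrt : √(β * (2 * L)) - t = √β' * √(2 * L) := by
    rw [hsqrt, ht]
    ring
  have hr : (√(β * (2 * L)) - t) ^ 2 / (2 * k p) = β' * (L / k p) := by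
    rw [hrt, mul_pow, h2L, Real.sq_sqrt (by linarith)]
    field_simp
  have hbound : 2 ^ k p * (p * Real.exp (-((√(β * (2 * L)) - t) ^ 2 / (2 * k p)))) ≤
      Real.exp (-((β' - 1) / 2 * Real.log p)) := by
    have hLk : Real.log p - Real.log (k p) ≤ L / k p := by
      rw [le_div_iff₀ hk0]
      linarith
    have hkl' : (1 + β') * k p ≤ (β' - 1) / 2 * Real.log p := by
      have := mul_le_mul_of_nonneg_left hkl (by linarith : 0 ≤ 1 + β')
      refine this.trans_eq ?_
      field_simp
    have h2 : (2 : ℝ) ^ k p ≤ Real.exp (k p) := by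
      rw [← Real.exp_one_pow]
      exact pow_le_pow_left₀ zero_le_two (by linarith [Real.exp_one_gt_d9]) _
    -- Both `2 ^ k` and `k ^ β'` are absorbed into `exp ((1 + β') * k)`, which costs at most half of
    -- the exponent `(β' - 1) * log p`.
    have hlogk := Real.log_le_self hk0.le
    calc 2 ^ k p * (p * Real.exp (-((√(β * (2 * L)) - t) ^ 2 / (2 * k p))))
        ≤ Real.exp (k p) *
            (Real.exp (Real.log p) * Real.exp (-((√(β * (2 * L)) - t) ^ 2 / (2 * k p)))) := by
          rw [Real.exp_log hp]
          gcongr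
      _ = Real.exp (k p + (Real.log p - β' * (L / k p))) := by
          rw [← Real.exp_add, ← Real.exp_add, hr, sub_eq_add_neg]
      _ ≤ _ := by
          rw [Real.exp_le_exp]
          nlinarith [mul_le_mul_of_nonneg_left hLk (by linarith : 0 ≤ β'),
            mul_le_mul_of_nonneg_left hlogk (by linarith : 0 ≤ β')]
  have hpq : p * Real.exp (-((√(β * (2 * L)) - t) ^ 2 / (2 * k p))) ≤ 1 := by
    refine (le_mul_of_one_le_left (by positivity) (one_le_pow₀ one_le_two)).trans
      (hbound.trans (Real.exp_le_one_iff.2 ?_))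
    exact neg_nonpos.2 (by positivity)
  have hmain := hmle.errorProb_le_of_gap hd hk1 hkp (by positivity) (t := t) (by positivity)
    (sub_nonneg.1 (by rw [hrt]; positivity)) hpq
  have htsq : t ^ 2 / 2 = (√β - √β') ^ 2 * L := by
    rw [ht, mul_pow, h2L]
    ring
  rw [htsq] at hmain
  exact hmain.trans (add_le_add le_rfl hbound)

theorem quarter_le_liminf {d : ℕ} (hd : d ≠ 0) (hk : ∀ᶠ p in atTop, 1 ≤ k p)
    (hko : (fun p : ℕ => (k p : ℝ)) =o[atTop] fun p : ℕ => Real.log p) {β : ℝ} (hβ0 : 0 ≤ β)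
    (hβ1 : β < 1) {e : ℕ → ℝ}
    (he : ∀ᶠ p in atTop, ∃ Xhat : Tensor d p → Tensor d p,
      IsMLE d p (k p) (β * critSNR p (k p)) Xhat ∧
        errorProb d p (k p) (β * critSNR p (k p)) Xhat = e p) :
    1 / 4 ≤ liminf e atTop := by
  -- A real `liminf` is only meaningful under such a bound, which supplies the coboundedness needed
  -- below.
  have hle1 : ∀ᶠ p in atTop, e p ≤ 1 := by
    filter_upwards [he, hk, eventually_le_self hko] with p ⟨X, hX, hXe⟩ hk1 hkp
    rw [← hXe, errorProb_eq_one_sub hk1 hkp hX.1]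
    exact sub_le_self _ (by positivity)
  refine le_liminf_of_le (isBoundedUnder_of_eventually_le hle1).isCoboundedUnder_ge ?_
  filter_upwards [he, eventually_le_errorProb hd hk hko hβ0 hβ1 (by norm_num : (1 / 4 : ℝ) < 1)]
    with p ⟨X, hX, hXe⟩ hp
  exact hXe ▸ hp X hX.1

theorem tendsto_zero_of_isMLE {d : ℕ} (hd : 2 ≤ d) (hk : ∀ᶠ p in atTop, 1 ≤ k p)
    (hko : (fun p : ℕ => (k p : ℝ)) =o[atTop] fun p : ℕ => Real.log p) {β : ℝ} (hβ : 1 < β)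
    {e : ℕ → ℝ}
    (he : ∀ᶠ p in atTop, ∃ Xhat : Tensor d p → Tensor d p,
      IsMLE d p (k p) (β * critSNR p (k p)) Xhat ∧
        errorProb d p (k p) (β * critSNR p (k p)) Xhat = e p) :
    Tendsto e atTop (𝓝 0) := by
  obtain ⟨b, hb, hle⟩ := exists_tendsto_zero_errorProb_le hd hk hko hβ
  refine tendsto_of_tendsto_of_tendsto_of_le_of_le' tendsto_const_nhds hb ?_ ?_
  · filter_upwards [he] with p ⟨X, _, hXe⟩
    exact hXe ▸ measureReal_nonneg
  · filter_upwards [he, hle] with p ⟨X, hX, hXe⟩ hp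
    exact hXe ▸ hp X hX

end Asymptotics

end SparsePCA

theorem theorem2 (d : ℕ) (hd : 2 ≤ d) (k : ℕ → ℕ)
    (hk : ∀ᶠ p in atTop, 1 ≤ k p)
    (hko : (fun p : ℕ => (k p : ℝ)) =o[atTop]
      fun p : ℕ => Real.log (p : ℝ) ^ ((1 : ℝ) / (4 * (d : ℝ) - 1))) :
    -- the minimum error probability is the error probability of the MLE
    (∀ p : ℕ, 1 ≤ k p → k p ≤ p → ∀ lam : ℝ, 0 ≤ lam →
      (∃ Xhat, SparsePCA.IsMLE d p (k p) lam Xhat) ∧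
      ∀ Xhat, SparsePCA.IsMLE d p (k p) lam Xhat →
        SparsePCA.errorProb d p (k p) lam Xhat = SparsePCA.MEP d p (k p) lam ∧
        SparsePCA.errorProb d p (k p) lam Xhat = SparsePCA.CMEP d p (k p) lam) ∧
    -- the transition for the minimum error probability
    (∀ β : ℝ, 0 ≤ β → β < 1 →
      1 / 4 ≤ liminf (fun p => SparsePCA.MEP d p (k p) (β * SparsePCA.critSNR p (k p))) atTop) ∧
    (∀ β : ℝ, 1 < β →
      Tendsto (fun p => SparsePCA.MEP d p (k p) (β * SparsePCA.critSNR p (k p))) atTop (𝓝 0)) ∧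
    -- the transition for the constrained minimum error probability
    (∀ β : ℝ, 0 ≤ β → β < 1 →
      1 / 4 ≤ liminf (fun p => SparsePCA.CMEP d p (k p) (β * SparsePCA.critSNR p (k p))) atTop) ∧
    (∀ β : ℝ, 1 < β →
      Tendsto (fun p => SparsePCA.CMEP d p (k p) (β * SparsePCA.critSNR p (k p))) atTop (𝓝 0)) := by
  have hd0 : d ≠ 0 := by omega
  have hd' : (2 : ℝ) ≤ d := by exact_mod_cast hd
  have hexp : (1 : ℝ) / (4 * (d : ℝ) - 1) ≤ 1 := div_le_one_of_le₀ (by linarith) (by linarith)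
  have hlog := SparsePCA.isLittleO_log_of_isLittleO_rpow hexp hko
  have hMEP (β : ℝ) : ∀ᶠ p in atTop, ∃ Xhat : SparsePCA.Tensor d p → SparsePCA.Tensor d p,
      SparsePCA.IsMLE d p (k p) (β * SparsePCA.critSNR p (k p)) Xhat ∧
        SparsePCA.errorProb d p (k p) (β * SparsePCA.critSNR p (k p)) Xhat =
          SparsePCA.MEP d p (k p) (β * SparsePCA.critSNR p (k p)) := by
    filter_upwards [hk, SparsePCA.eventually_le_self hlog] with p hk1 hkp
    obtain ⟨X, hX⟩ := SparsePCA.exists_isMLE d hk1 hkp (β * SparsePCA.critSNR p (k p))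
    exact ⟨X, hX, hX.errorProb_eq_MEP hd0 hk1 hkp⟩
  have hCMEP (β : ℝ) : ∀ᶠ p in atTop, ∃ Xhat : SparsePCA.Tensor d p → SparsePCA.Tensor d p,
      SparsePCA.IsMLE d p (k p) (β * SparsePCA.critSNR p (k p)) Xhat ∧
        SparsePCA.errorProb d p (k p) (β * SparsePCA.critSNR p (k p)) Xhat =
          SparsePCA.CMEP d p (k p) (β * SparsePCA.critSNR p (k p)) := by
    filter_upwards [hk, SparsePCA.eventually_le_self hlog] with p hk1 hkp
    obtain ⟨X, hX⟩ := SparsePCA.exists_isMLE d hk1 hkp (β * SparsePCA.critSNR p (k p))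
    exact ⟨X, hX, hX.errorProb_eq_CMEP hd0 hk1 hkp⟩
  refine ⟨fun p hk1 hkp lam _ => ⟨SparsePCA.exists_isMLE d hk1 hkp lam, fun X hX =>
      ⟨hX.errorProb_eq_MEP hd0 hk1 hkp, hX.errorProb_eq_CMEP hd0 hk1 hkp⟩⟩,
    fun β hβ0 hβ1 => SparsePCA.quarter_le_liminf hd0 hk hlog hβ0 hβ1 (hMEP β),
    fun β hβ => SparsePCA.tendsto_zero_of_isMLE hd hk hlog hβ (hMEP β),
    fun β hβ0 hβ1 => SparsePCA.quarter_le_liminf hd0 hk hlog hβ0 hβ1 (hCMEP β),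
    fun β hβ => SparsePCA.tendsto_zero_of_isMLE hd hk hlog hβ (hCMEP β)⟩
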